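/- A delta-matroid with finite ground set $E$ is a pair $(E,\mathcal F)$, where $\mathcal F$ is a non-empty collection of subsets of $E$ (the feasible sets) such that for all $X,Y\in\mathcal F$ and every $e\in X\bigtriangleup Y$ there is $f\in X\bigtriangleup Y$ (possibly $f=e$) with $X\bigtriangleup\{e,f\}\in\mathcal F$. It is called even if the sizes of its feasible sets all have the same parity. Let $e_n$ denote the number of labelled even delta-matroids with ground set $[n]=\{1,\ldots,n\}$, and let $\log$ denote the logarithm to base two. Then for every integer $n\ge 1$ $$n-\log n-1\le \log\log e_n\le n-\log n+O(\log\log n),$$ where the term $O(\log\log n)$ stands for a function $g(n)$ for which there are constants $C$ and $n_0$ with $|g(n)|\le C\log\log n$ for all $n\ge n_0$. -/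

import Mathlib

/-- A delta-matroid with finite ground set `α`: a non-empty collection of subsets of `α`
(the feasible sets) satisfying the symmetric exchange axiom. In the axiom `f = e` is permitted. -/
@[ext]
structure DeltaMatroid (α : Type*) [DecidableEq α] [Fintype α] where
  /-- The collection of feasible sets. -/
  feasible : Finset (Finset α)
  nonempty : feasible.Nonempty
  symm_exchange : ∀ X ∈ feasible, ∀ Y ∈ feasible, ∀ e ∈ symmDiff X Y,
    ∃ f ∈ symmDiff X Y, symmDiff X {e, f} ∈ feasible

namespace DeltaMatroid

variable {α : Type*} [DecidableEq α] [Fintype α]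

/-- A delta-matroid is even if the sizes of its feasible sets all have the same parity. -/
def IsEven (D : DeltaMatroid α) : Prop :=
  ∀ X ∈ D.feasible, ∀ Y ∈ D.feasible, X.card ≡ Y.card [MOD 2]

instance instFinite : Finite (DeltaMatroid α) :=
  Finite.of_injective DeltaMatroid.feasible fun _ _ h => DeltaMatroid.ext h

end DeltaMatroid

/-- The number of labelled even delta-matroids on a fixed ground set with `n` elements. -/
noncomputable def numEvenDeltaMatroids (n : ℕ) : ℕ :=
  Nat.card {D : DeltaMatroid (Fin n) // D.IsEven}

/-!
Both bounds are read in the graph on the subsets of `Fin n` whose edges join sets at distance two.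
Its edges are covered by the cliques `{symmDiff Z {f} | f}`, of size `n`, one for each set `Z`.

*Lower bound.* In an exchange from `X` towards `Y` on `e`, the candidates `symmDiff X {e, f}` lie in
the clique centred at `symmDiff X {e}`, and there are at least three with `f ≠ e` unless `X` and `Y`
are at distance two, where `Y` itself is a candidate. So a family `N` meeting every clique in at
most two sets may be declared infeasible among the sets of a given parity
(`DeltaMatroid.ofSparse`). With `2 ^ k ≤ n < 2 ^ (k + 1)`, label the ground set by `(ZMod 2) ^ k`
using each label at most twice, and colour a set by its parity and the sum of its labels. Every
subfamily of a colour class is such an `N`, and some class has at least `2 ^ (n - 1 - k)` members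
(`two_pow_two_pow_le_numEvenDeltaMatroids`). Allowing two sets per clique rather than one is what
absorbs the rounding of `log n`.

*Upper bound.* This is a container argument. If `V` is infeasible in an even delta-matroid, the
pairs `{a, b}` for which `symmDiff V {a, b}` is feasible form a complete multipartite graph on some
of the elements, so the feasible neighbours of `V` follow one of at most `(n + 1) ^ n` patterns
(`DeltaMatroid.card_traces_pairNeighbors_le`). On the other hand Cauchy–Schwarz over the cliques
gives each family `S` with more than `2 * 2 ^ n / n` members a member adjacent to a proportion
`n ^ 2 / (4 * 2 ^ n)` of `S` (`Finset.exists_mem_le_card_inter_pairNeighbors`). Branching on whether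
that member is feasible, where infeasibility settles all its neighbours at the cost of one pattern,
reduces `S` to `2 * 2 ^ n / n` sets in about `2 ^ n * log n / n ^ 2` infeasible branchings
(`Finset.card_traces_le_of_expansion`). Each costs `O(n * log n)` bits, so the logarithm of the
number of even delta-matroids is `O(2 ^ n * (log n) ^ 2 / n)`.
-/

/-! ### Sums over symmetric differences and parity -/

theorem Finset.sum_symmDiff_of_add_self {α G : Type*} [DecidableEq α] [AddCommGroup G]
    (hG : ∀ g : G, g + g = 0) (c : α → G) (X Y : Finset α) :
    ∑ i ∈ symmDiff X Y, c i = ∑ i ∈ X, c i + ∑ i ∈ Y, c i := by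
  have h1 : ∑ i ∈ symmDiff X Y, c i = ∑ i ∈ X \ Y, c i + ∑ i ∈ Y \ X, c i :=
    Finset.sum_union disjoint_sdiff_sdiff
  have h2 := Finset.sum_inter_add_sum_sdiff X Y c
  have h3 := Finset.sum_inter_add_sum_sdiff Y X c
  rw [Finset.inter_comm] at h3
  rw [h1, ← h2, ← h3]
  have := hG (∑ i ∈ X ∩ Y, c i)
  calc _ = (∑ i ∈ X ∩ Y, c i + ∑ i ∈ X ∩ Y, c i)
        + (∑ i ∈ X \ Y, c i + ∑ i ∈ Y \ X, c i) := by rw [this, zero_add]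
    _ = _ := by abel

theorem Finset.card_symmDiff_zmod_two {α : Type*} [DecidableEq α] (X Y : Finset α) :
    ((symmDiff X Y).card : ZMod 2) = X.card + Y.card := by
  simpa using Finset.sum_symmDiff_of_add_self CharTwo.add_self_eq_zero
    (fun _ : α => (1 : ZMod 2)) X Y

theorem Finset.symmDiff_pair {α : Type*} [DecidableEq α] (X : Finset α) {e f : α} (h : e ≠ f) :
    symmDiff X {e, f} = symmDiff (symmDiff X {e}) {f} := by
  have : symmDiff ({e} : Finset α) {f} = {e, f} := by
    ext x; simp only [Finset.mem_symmDiff, Finset.mem_singleton, Finset.mem_insert]; grind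
  rw [symmDiff_assoc, this]

/-! ### Even delta-matroids with few infeasible sets -/

namespace DeltaMatroid

variable {α : Type*} [DecidableEq α] [Fintype α]

/-- The delta-matroid with a single feasible set. -/
def single (X : Finset α) : DeltaMatroid α where
  feasible := {X}
  nonempty := ⟨X, by simp⟩
  symm_exchange := by simp

theorem isEven_single (X : Finset α) : (single X).IsEven := by
  intro Y hY Z hZ
  simp only [single, Finset.mem_singleton] at hY hZ
  rw [hY, hZ]

/-- The even delta-matroid whose feasible sets are all sets of parity `p` outside `N`. The exchange
axiom holds as soon as, among the sets `symmDiff Z {f}` around any centre `Z`, at most two lie in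
`N`: feasible sets at distance four or more leave at least three candidates for the exchange. -/
def ofSparse (p : ZMod 2) (N : Finset (Finset α))
    (hne : ∃ X : Finset α, (X.card : ZMod 2) = p ∧ X ∉ N)
    (hN : ∀ Z : Finset α, (Finset.univ.filter fun f => symmDiff Z {f} ∈ N).card ≤ 2) :
    DeltaMatroid α where
  feasible := Finset.univ.filter fun X => (X.card : ZMod 2) = p ∧ X ∉ N
  nonempty := by
    obtain ⟨X, hX⟩ := hne
    exact ⟨X, by simpa using hX⟩
  symm_exchange := by
    intro X hX Y hY e he
    simp only [Finset.mem_filter, Finset.mem_univ, true_and] at hX hY ⊢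
    by_contra! hcon
    have hpar : ((symmDiff X Y).card : ZMod 2) = 0 := by
      rw [Finset.card_symmDiff_zmod_two, hX.1, hY.1, CharTwo.add_self_eq_zero]
    have hall : ∀ f ∈ (symmDiff X Y).erase e, symmDiff X {e, f} ∈ N := by
      intro f hf
      rw [Finset.mem_erase] at hf
      refine hcon f hf.2 ?_
      rw [Finset.card_symmDiff_zmod_two, Finset.card_pair hf.1.symm, hX.1]
      have : ((2 : ℕ) : ZMod 2) = 0 := by decide
      rw [this, add_zero]
    have hle : ((symmDiff X Y).erase e).card ≤ 2 := by
      refine le_trans (Finset.card_le_card ?_) (hN (symmDiff X {e}))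
      intro f hf
      have := hall f hf
      rw [Finset.symmDiff_pair X (Finset.ne_of_mem_erase hf).symm] at this
      simpa using this
    rw [Finset.card_erase_of_mem he] at hle
    have hpos := Finset.card_pos.2 ⟨e, he⟩
    rw [ZMod.natCast_eq_zero_iff] at hpar
    have h2 : (symmDiff X Y).card = 2 := by omega
    obtain ⟨f, hf⟩ : ((symmDiff X Y).erase e).Nonempty := by
      rw [← Finset.card_pos, Finset.card_erase_of_mem he, h2]; norm_num
    have hXY : symmDiff X Y = {e, f} := by
      rw [Finset.mem_erase] at hf
      symm
      apply Finset.eq_of_subset_of_card_le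
      · intro x hx
        simp only [Finset.mem_insert, Finset.mem_singleton] at hx
        rcases hx with rfl | rfl
        exacts [he, hf.2]
      · rw [Finset.card_pair hf.1.symm, h2]
    have := hall f hf
    rw [← hXY, symmDiff_symmDiff_cancel_left] at this
    exact hY.2 this

theorem isEven_ofSparse (p : ZMod 2) (N : Finset (Finset α)) (hne hN) :
    (ofSparse p N hne hN).IsEven := by
  intro X hX Y hY
  simp only [ofSparse, Finset.mem_filter, Finset.mem_univ, true_and] at hX hY
  rw [← ZMod.natCast_eq_natCast_iff, hX.1, hY.1]

end DeltaMatroid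

theorem two_pow_le_numEvenDeltaMatroids (n : ℕ) : 2 ^ n ≤ numEvenDeltaMatroids n := by
  have h : Function.Injective (fun X : Finset (Fin n) =>
      (⟨DeltaMatroid.single X, DeltaMatroid.isEven_single X⟩ :
        {D : DeltaMatroid (Fin n) // D.IsEven})) := by
    intro X Y hXY
    have := congrArg (fun D => D.1.feasible) hXY
    simpa [DeltaMatroid.single] using this
  simpa [numEvenDeltaMatroids] using Nat.card_le_card_of_injective _ h

/-- A labelling `c` of the ground set by a group of exponent two colours each set by its parity and
the sum of its labels. When no label is used more than twice, every subfamily of a colour class may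
serve as the infeasible family of an even delta-matroid. -/
theorem two_pow_card_colour_class_le {n : ℕ} {G : Type*} [AddCommGroup G] [DecidableEq G]
    (hG : ∀ g : G, g + g = 0) (c : Fin n → G)
    (hc : ∀ g, (Finset.univ.filter fun i => c i = g).card ≤ 2)
    {a b : Fin n} (hab : c a ≠ c b) (y : ZMod 2 × G) :
    2 ^ (Finset.univ.filter fun X : Finset (Fin n) => ∑ i ∈ X, ((1 : ZMod 2), c i) = y).card
      ≤ numEvenDeltaMatroids n := by
  set C := Finset.univ.filter fun X : Finset (Fin n) => ∑ i ∈ X, ((1 : ZMod 2), c i) = y with hC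
  have hG' : ∀ g : ZMod 2 × G, g + g = 0 := fun g =>
    Prod.ext (CharTwo.add_self_eq_zero g.1) (hG g.2)
  have hfst : ∀ X : Finset (Fin n), (∑ i ∈ X, ((1 : ZMod 2), c i)).1 = (X.card : ZMod 2) := by
    intro X; simp [Prod.fst_sum]
  rcases C.eq_empty_or_nonempty with h0 | ⟨X₀, hX₀⟩
  · rw [h0, Finset.card_empty]
    exact (pow_le_pow_right₀ one_le_two (Nat.zero_le n)).trans (two_pow_le_numEvenDeltaMatroids n)
  have hX₀' : ∑ i ∈ X₀, ((1 : ZMod 2), c i) = y := by simpa [hC] using hX₀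
  have hne : ∀ N ⊆ C, ∃ X : Finset (Fin n), (X.card : ZMod 2) = y.1 ∧ X ∉ N := by
    -- Exchanging `a` and `b` in `X₀` keeps the parity and changes the sum of labels.
    intro N hN
    have hne : a ≠ b := fun h => hab (congrArg c h)
    have hs := Finset.sum_symmDiff_of_add_self hG' (fun i => ((1 : ZMod 2), c i)) X₀ {a, b}
    rw [Finset.sum_pair hne, hX₀'] at hs
    refine ⟨symmDiff X₀ {a, b}, ?_, fun hmem => ?_⟩
    · rw [← hfst, hs]
      simp [CharTwo.add_self_eq_zero]
    · have h1 := hN hmem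
      simp only [hC, Finset.mem_filter, Finset.mem_univ, true_and] at h1
      rw [hs] at h1
      have h2 : c a + c b = 0 := by
        have := congrArg Prod.snd (add_eq_left.1 h1)
        simpa using this
      exact hab ((eq_neg_of_add_eq_zero_left h2).trans (neg_eq_of_add_eq_zero_left (hG _)))
  have hsp : ∀ N ⊆ C, ∀ Z : Finset (Fin n),
      (Finset.univ.filter fun f => symmDiff Z {f} ∈ N).card ≤ 2 := by
    intro N hN Z
    refine le_trans (Finset.card_le_card ?_) (hc ((y - ∑ i ∈ Z, ((1 : ZMod 2), c i)).2))
    intro f hf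
    simp only [Finset.mem_filter, Finset.mem_univ, true_and] at hf ⊢
    have h1 := hN hf
    simp only [hC, Finset.mem_filter, Finset.mem_univ, true_and] at h1
    rw [Finset.sum_symmDiff_of_add_self hG', Finset.sum_singleton] at h1
    rw [← h1, add_sub_cancel_left]
  let F : {N // N ∈ C.powerset} → {D : DeltaMatroid (Fin n) // D.IsEven} := fun N =>
    ⟨DeltaMatroid.ofSparse y.1 N.1 (hne _ (Finset.mem_powerset.1 N.2))
      (hsp _ (Finset.mem_powerset.1 N.2)), DeltaMatroid.isEven_ofSparse _ _ _ _⟩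
  have hF : Function.Injective F := by
    rintro ⟨N, hN⟩ ⟨N', hN'⟩ h
    have h1 := congrArg (fun D => D.1.feasible) h
    simp only [F, DeltaMatroid.ofSparse] at h1
    rw [Finset.mem_powerset] at hN hN'
    have hmemC : ∀ X ∈ C, (X.card : ZMod 2) = y.1 := by
      intro X hX
      rw [← hfst, (Finset.mem_filter.1 hX).2]
    apply Subtype.ext
    ext X
    have h2 : ((X.card : ZMod 2) = y.1 ∧ X ∉ N) ↔ ((X.card : ZMod 2) = y.1 ∧ X ∉ N') := by
      simpa using Finset.ext_iff.1 h1 X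
    have h3 : X ∈ N → (X.card : ZMod 2) = y.1 := fun h => hmemC X (hN h)
    have h4 : X ∈ N' → (X.card : ZMod 2) = y.1 := fun h => hmemC X (hN' h)
    show X ∈ N ↔ X ∈ N'
    tauto
  have := Nat.card_le_card_of_injective F hF
  rwa [Nat.card_eq_fintype_card, Fintype.card_coe, Finset.card_powerset] at this

theorem two_pow_two_pow_le_numEvenDeltaMatroids {n k : ℕ} (hk : 1 ≤ k) (h1 : 2 ^ k ≤ n)
    (h2 : n ≤ 2 ^ (k + 1)) : 2 ^ 2 ^ (n - 1 - k) ≤ numEvenDeltaMatroids n := by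
  have hkn : k < n := Nat.lt_two_pow_self.trans_le h1
  have h2k : 2 ≤ 2 ^ k := by simpa using Nat.pow_le_pow_right two_pos hk
  let φ : Fin (2 ^ k) ≃ (Fin k → ZMod 2) :=
    (Fintype.equivFinOfCardEq (by simp [ZMod.card])).symm
  let c : Fin n → (Fin k → ZMod 2) := fun i => φ ⟨i % 2 ^ k, Nat.mod_lt _ (by positivity)⟩
  have hG : ∀ g : Fin k → ZMod 2, g + g = 0 := fun g =>
    funext fun j => CharTwo.add_self_eq_zero (g j)
  have hc : ∀ g, (Finset.univ.filter fun i => c i = g).card ≤ 2 := by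
    intro g
    -- An element with a given residue modulo `2 ^ k` is determined by its quotient, `0` or `1`.
    refine le_trans (Finset.card_le_card_of_injOn (t := Finset.range 2)
      (fun i : Fin n => (i : ℕ) / 2 ^ k) ?_ ?_) (Finset.card_range 2).le
    · intro i _
      have : (i : ℕ) < 2 * 2 ^ k := by have := i.2; rw [pow_succ] at h2; omega
      exact Finset.mem_coe.2 (Finset.mem_range.2 (Nat.div_lt_of_lt_mul (by rwa [mul_comm])))
    · intro i hi j hj hij
      simp only [Finset.coe_filter, Finset.mem_univ, true_and, Set.mem_ofPred_eq] at hi hj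
      have hm : (i : ℕ) % 2 ^ k = j % 2 ^ k := by
        simpa [c] using hi.trans hj.symm
      apply Fin.ext
      rw [← Nat.div_add_mod (i : ℕ) (2 ^ k), ← Nat.div_add_mod (j : ℕ) (2 ^ k), hm]
      simp only at hij
      rw [hij]
  have hab : c ⟨0, by omega⟩ ≠ c ⟨1, by omega⟩ := by
    intro h
    have : 0 % 2 ^ k = 1 % 2 ^ k := by simpa [c] using h
    rw [Nat.zero_mod, Nat.mod_eq_of_lt (by omega)] at this
    omega
  obtain ⟨y, hy⟩ := Fintype.exists_le_card_fiber_of_mul_le_card (n := 2 ^ (n - 1 - k))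
    (fun X : Finset (Fin n) => ∑ i ∈ X, ((1 : ZMod 2), c i)) (by
      simp only [Fintype.card_prod, ZMod.card, Fintype.card_fun, Fintype.card_fin,
        Fintype.card_finset]
      rw [← pow_succ', ← pow_add]
      exact Nat.pow_le_pow_right two_pos (by omega))
  exact (Nat.pow_le_pow_right two_pos hy).trans (two_pow_card_colour_class_le hG c hc hab y)

theorem sub_logb_sub_one_le_logb_logb_numEvenDeltaMatroids {n : ℕ} (hn : 1 ≤ n) :
    (n : ℝ) - Real.logb 2 n - 1 ≤ Real.logb 2 (Real.logb 2 (numEvenDeltaMatroids n : ℝ)) := by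
  rcases hn.eq_or_lt with rfl | hn2
  · have h := two_pow_le_numEvenDeltaMatroids 1
    have h1 : (1 : ℝ) ≤ Real.logb 2 (numEvenDeltaMatroids 1 : ℝ) := by
      rw [Real.le_logb_iff_rpow_le one_lt_two (by
        exact_mod_cast (pow_pos two_pos 1).trans_le h)]
      exact_mod_cast h
    simpa using Real.logb_nonneg one_lt_two h1
  · set k := Nat.log 2 n with hk
    have h1 : 2 ^ k ≤ n := Nat.pow_log_le_self 2 (by omega)
    have h2 : n ≤ 2 ^ (k + 1) := (Nat.lt_pow_succ_log_self one_lt_two n).le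
    have hk1 : 1 ≤ k := Nat.log_pos one_lt_two hn2
    have h := two_pow_two_pow_le_numEvenDeltaMatroids hk1 h1 h2
    have hkn : k < n := Nat.lt_two_pow_self.trans_le h1
    have hpos : (0 : ℝ) < numEvenDeltaMatroids n := by
      exact_mod_cast (pow_pos two_pos _).trans_le h
    have h3 : ((2 : ℝ) ^ (n - 1 - k)) ≤ Real.logb 2 (numEvenDeltaMatroids n : ℝ) := by
      rw [Real.le_logb_iff_rpow_le one_lt_two hpos]
      exact_mod_cast h
    have h4 : ((n - 1 - k : ℕ) : ℝ) ≤ Real.logb 2 (Real.logb 2 (numEvenDeltaMatroids n : ℝ)) := by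
      rw [Real.le_logb_iff_rpow_le one_lt_two (lt_of_lt_of_le (by positivity) h3)]
      exact_mod_cast h3
    have h5 : (k : ℝ) ≤ Real.logb 2 n := by
      rw [Real.le_logb_iff_rpow_le one_lt_two (by exact_mod_cast hn)]
      exact_mod_cast h1
    refine le_trans ?_ h4
    rw [Nat.cast_sub (by omega), Nat.cast_sub hn]
    push_cast
    linarith

/-! ### Counting traces of a set family in a locally constrained graph -/

/-- The traces on `S` of the members of a set family. -/
def Finset.traces {V : Type*} [DecidableEq V] (ℱ : Finset (Finset V)) (S : Finset V) :
    Finset (Finset V) :=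
  ℱ.image fun F => F ∩ S

theorem Finset.card_traces_le_two_pow {V : Type*} [DecidableEq V] (ℱ : Finset (Finset V))
    (S : Finset V) : (ℱ.traces S).card ≤ 2 ^ S.card := by
  rw [← Finset.card_powerset]
  refine Finset.card_le_card fun T hT => ?_
  obtain ⟨F, -, rfl⟩ := Finset.mem_image.1 hT
  exact Finset.mem_powerset.2 Finset.inter_subset_right

/-- Branching on a vertex `v`: members containing `v` are determined by the rest of `S`, and the
trace of the others splits into a local part on `nb` and a part outside `nb`. -/
theorem Finset.card_traces_le_add_mul {V : Type*} [DecidableEq V] (ℱ : Finset (Finset V))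
    (S : Finset V) {v : V} (hv : v ∈ S) (nb : Finset V) :
    (ℱ.traces S).card ≤ (ℱ.traces (S.erase v)).card
      + ((ℱ.filter fun F => v ∉ F).traces nb).card * (ℱ.traces (S \ nb)).card := by
  have hsplit : ℱ.traces S =
      (ℱ.filter fun F => v ∈ F).traces S ∪ (ℱ.filter fun F => v ∉ F).traces S := by
    simp only [Finset.traces]
    rw [← Finset.image_union, Finset.filter_union_filter_not_eq]
  rw [hsplit]
  refine (Finset.card_union_le _ _).trans (Nat.add_le_add ?_ ?_)
  · refine le_trans (Finset.card_le_card (t := (ℱ.traces (S.erase v)).image (insert v)) ?_)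
      Finset.card_image_le
    intro T hT
    obtain ⟨F, hF, rfl⟩ := Finset.mem_image.1 hT
    rw [Finset.mem_filter] at hF
    refine Finset.mem_image.2 ⟨F ∩ S.erase v, Finset.mem_image_of_mem _ hF.1, ?_⟩
    ext x
    simp only [Finset.mem_insert, Finset.mem_inter, Finset.mem_erase]
    by_cases hx : x = v
    · simp [hx, hv, hF.2]
    · simp [hx]
  · rw [← Finset.card_product]
    refine le_trans (Finset.card_le_card (t :=
      (((ℱ.filter fun F => v ∉ F).traces nb) ×ˢ (ℱ.traces (S \ nb))).image
        fun p => (p.1 ∩ S) ∪ p.2) ?_) Finset.card_image_le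
    intro T hT
    obtain ⟨F, hF, rfl⟩ := Finset.mem_image.1 hT
    refine Finset.mem_image.2 ⟨(F ∩ nb, F ∩ (S \ nb)), Finset.mem_product.2
      ⟨Finset.mem_image_of_mem _ hF, Finset.mem_image_of_mem _ (Finset.mem_filter.1 hF).1⟩, ?_⟩
    ext x
    simp only [Finset.mem_union, Finset.mem_inter, Finset.mem_sdiff]
    tauto

/-- If every vertex set with more than `s₀` elements has a vertex adjacent to a proportion `β` of it,
and the members of `ℱ` avoiding a vertex have at most `L` traces on its neighbourhood, then `ℱ` has
few traces on `S`. Here `q` steps of shrinking by the factor `1 - β` bring `S` to size `s₀`. -/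
theorem Finset.card_traces_le_of_expansion {V : Type*} [DecidableEq V] (ℱ : Finset (Finset V))
    (nb : V → Finset V) {L : ℕ}
    (hL : ∀ v, ((ℱ.filter fun F => v ∉ F).traces (nb v)).card ≤ L) {s₀ β : ℝ} (hs₀ : 0 ≤ s₀)
    (hβ : 0 < β)
    (hexp : ∀ S : Finset V, s₀ < S.card → ∃ v ∈ S, β * S.card ≤ (S ∩ nb v).card)
    (S : Finset V) (q : ℕ) (hq : (1 - β) ^ q * S.card ≤ s₀) :
    ((ℱ.traces S).card : ℝ) ≤ 2 ^ s₀ * (1 + S.card * L) ^ q := by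
  induction hs : S.card using Nat.strong_induction_on generalizing S q with
  | _ s ih =>
  subst hs
  by_cases hS : (S.card : ℝ) ≤ s₀
  · calc ((ℱ.traces S).card : ℝ) ≤ (2 : ℝ) ^ S.card := by
          exact_mod_cast Finset.card_traces_le_two_pow ℱ S
      _ = (2 : ℝ) ^ (S.card : ℝ) := (Real.rpow_natCast _ _).symm
      _ ≤ 2 ^ s₀ := Real.rpow_le_rpow_of_exponent_le one_le_two hS
      _ ≤ 2 ^ s₀ * (1 + S.card * L) ^ q := by
          apply le_mul_of_one_le_right (by positivity)
          apply one_le_pow₀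
          have : (0 : ℝ) ≤ S.card * L := by positivity
          linarith
  push Not at hS
  obtain ⟨q, rfl⟩ : ∃ r, q = r + 1 := by
    refine Nat.exists_eq_succ_of_ne_zero fun h => ?_
    rw [h] at hq
    linarith [hq]
  obtain ⟨v, hv, hdeg⟩ := hexp S hS
  have hpos : (0 : ℝ) < S.card := hs₀.trans_lt hS
  have hsplit : ((S \ nb v).card : ℝ) + (S ∩ nb v).card = S.card := by
    exact_mod_cast Finset.card_sdiff_add_card_inter S (nb v)
  have hsd : ((S \ nb v).card : ℝ) ≤ (1 - β) * S.card := by linarith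
  have hlt : (S \ nb v).card < S.card := by
    have : ((S \ nb v).card : ℝ) < S.card := by nlinarith
    exact_mod_cast this
  have hβ1 : 0 ≤ 1 - β := by
    by_contra! h
    have : ((S \ nb v).card : ℝ) < 0 := hsd.trans_lt (mul_neg_of_neg_of_pos h hpos)
    exact absurd this (not_lt.2 (Nat.cast_nonneg _))
  have hc : ((S.erase v).card : ℝ) = S.card - 1 := by
    rw [Finset.card_erase_of_mem hv, Nat.cast_sub (Finset.card_pos.2 ⟨v, hv⟩), Nat.cast_one]
  have h1 := ih _ (Finset.card_erase_lt_of_mem hv) (S.erase v) (q + 1) (by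
    refine le_trans ?_ hq
    apply mul_le_mul_of_nonneg_left _ (by positivity)
    linarith) rfl
  have h2 := ih _ hlt (S \ nb v) q (by
    refine le_trans ?_ hq
    rw [pow_succ, mul_assoc]
    exact mul_le_mul_of_nonneg_left hsd (by positivity)) rfl
  have hrec : ((ℱ.traces S).card : ℝ) ≤ (ℱ.traces (S.erase v)).card
      + L * (ℱ.traces (S \ nb v)).card := by
    have := (Finset.card_traces_le_add_mul ℱ S hv (nb v)).trans
      (Nat.add_le_add_left (Nat.mul_le_mul_right _ (hL v)) _)
    exact_mod_cast this
  rw [hc] at h1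
  set A : ℝ := 1 + S.card * L with hA
  have hS1 : (1 : ℝ) ≤ S.card := by exact_mod_cast Finset.card_pos.2 ⟨v, hv⟩
  have hL0 : (0 : ℝ) ≤ L := Nat.cast_nonneg L
  have hB : (0 : ℝ) ≤ 1 + ((S.card : ℝ) - 1) * L := by
    have := mul_nonneg (sub_nonneg.2 hS1) hL0
    linarith
  have hBA : 1 + ((S.card : ℝ) - 1) * L = A - L := by rw [hA]; ring
  have h2' : (1 + ((S \ nb v).card : ℝ) * L) ^ q ≤ A ^ q := by
    apply pow_le_pow_left₀ (by positivity)
    have : ((S \ nb v).card : ℝ) ≤ S.card := by exact_mod_cast hlt.le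
    rw [hA]
    have := mul_le_mul_of_nonneg_right this hL0
    linarith
  have h1' : (1 + ((S.card : ℝ) - 1) * L) ^ (q + 1) ≤ A ^ q * (A - L) := by
    rw [pow_succ, hBA]
    rw [hBA] at hB
    exact mul_le_mul_of_nonneg_right (pow_le_pow_left₀ hB (by linarith) q) hB
  have hp : (0 : ℝ) ≤ 2 ^ s₀ := by positivity
  calc ((ℱ.traces S).card : ℝ)
      ≤ 2 ^ s₀ * (1 + ((S.card : ℝ) - 1) * L) ^ (q + 1)
        + L * (2 ^ s₀ * (1 + ((S \ nb v).card : ℝ) * L) ^ q) :=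
        hrec.trans (add_le_add h1 (mul_le_mul_of_nonneg_left h2 hL0))
    _ ≤ 2 ^ s₀ * (A ^ q * (A - L)) + L * (2 ^ s₀ * A ^ q) := by gcongr
    _ = 2 ^ s₀ * A ^ (q + 1) := by ring

/-! ### Expansion in the graph of sets at distance two -/

/-- The sets obtained from `X` by switching the membership of exactly two elements. -/
def Finset.pairNeighbors {α : Type*} [DecidableEq α] [Fintype α] (X : Finset α) :
    Finset (Finset α) :=
  (Finset.univ.powersetCard 2).image (symmDiff X)

/-- Switching ordered pairs `(f, g)` reaches `S` from `X` at most twice per neighbour of `X`,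
and `Fintype.card α` more times through the pairs with `f = g`. -/
theorem Finset.card_switchings_le {α : Type*} [DecidableEq α] [Fintype α] (S : Finset (Finset α))
    (X : Finset α) :
    (Finset.univ.filter fun p : α × α => symmDiff (symmDiff X {p.1}) {p.2} ∈ S).card
      ≤ Fintype.card α + 2 * (S ∩ X.pairNeighbors).card := by
  set P := Finset.univ.filter fun p : α × α => symmDiff (symmDiff X {p.1}) {p.2} ∈ S with hP
  rw [← Finset.card_filter_add_card_filter_not (s := P) fun p => p.1 = p.2]
  refine Nat.add_le_add ?_ ?_
  · refine le_trans (Finset.card_le_card_of_injOn (t := Finset.univ) Prod.fst (by simp) ?_)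
      Finset.card_univ.le
    rintro ⟨a, b⟩ hp ⟨c, d⟩ hq h
    simp only [Finset.coe_filter, Set.mem_ofPred_eq] at hp hq h
    rw [Prod.mk.injEq]
    exact ⟨h, by rw [← hp.2, ← hq.2, h]⟩
  · refine Finset.card_le_mul_card_image_of_maps_to (f := fun p => symmDiff X {p.1, p.2}) ?_ 2 ?_
    · intro p hp
      simp only [hP, Finset.mem_filter, Finset.mem_univ, true_and] at hp
      rw [Finset.mem_inter, Finset.symmDiff_pair X hp.2]
      refine ⟨hp.1, ?_⟩
      rw [← Finset.symmDiff_pair X hp.2]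
      exact Finset.mem_image_of_mem _
        (Finset.mem_powersetCard.2 ⟨Finset.subset_univ _, Finset.card_pair hp.2⟩)
    · intro W hW
      obtain ⟨T, hT, rfl⟩ := Finset.mem_image.1 (Finset.mem_inter.1 hW).2
      have hT2 := (Finset.mem_powersetCard.1 hT).2
      refine le_trans (Finset.card_le_card (t := T.offDiag) ?_)
        (by rw [Finset.offDiag_card, hT2])
      rintro ⟨a, b⟩ hp
      simp only [Finset.mem_filter] at hp
      have hab : {a, b} = T := symmDiff_right_injective X hp.2
      rw [Finset.mem_offDiag, ← hab]
      exact ⟨by simp, by simp, hp.1.2⟩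

/-- Counting the pairs `(X, f)` with `X ∈ S` around the centres `symmDiff X {f}` and applying
Cauchy–Schwarz shows that a large family has a member with many neighbours in it. -/
theorem Finset.exists_mem_card_sq_le_pairNeighbors {α : Type*} [DecidableEq α] [Fintype α]
    {S : Finset (Finset α)} (hS : S.Nonempty) :
    ∃ X ∈ S, Fintype.card α ^ 2 * S.card
      ≤ 2 ^ Fintype.card α * (Fintype.card α + 2 * (S ∩ X.pairNeighbors).card) := by
  set n := Fintype.card α with hn
  let d : Finset α → ℕ := fun Z => (Finset.univ.filter fun f => symmDiff Z {f} ∈ S).card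
  have hcount : ∀ w : Finset α → ℕ, ∑ Z, w Z * d Z = ∑ X ∈ S, ∑ f, w (symmDiff X {f}) := by
    intro w
    have : ∀ f : α, ∑ Z, (if symmDiff Z {f} ∈ S then w Z else 0)
        = ∑ X, (if X ∈ S then w (symmDiff X {f}) else 0) := by
      intro f
      refine Fintype.sum_equiv (symmDiff_left_involutive ({f} : Finset α)).toPerm _ _ fun Z => ?_
      simp
    calc ∑ Z, w Z * d Z = ∑ Z, ∑ f, (if symmDiff Z {f} ∈ S then w Z else 0) := by
          refine Finset.sum_congr rfl fun Z _ => ?_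
          rw [← Finset.sum_filter, Finset.sum_const, smul_eq_mul, mul_comm]
      _ = ∑ f, ∑ X, (if X ∈ S then w (symmDiff X {f}) else 0) := by
          rw [Finset.sum_comm]
          exact Finset.sum_congr rfl fun f _ => this f
      _ = _ := by
          rw [Finset.sum_comm, ← Finset.sum_filter_add_sum_filter_not Finset.univ (· ∈ S)]
          simp +contextual
  have hsum : ∑ Z, d Z = n * S.card := by
    simpa [mul_comm] using hcount fun _ => 1
  have hsq : ∑ Z, d Z ^ 2 ≤ ∑ X ∈ S, (n + 2 * (S ∩ X.pairNeighbors).card) := by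
    simp_rw [sq]
    rw [hcount d]
    refine Finset.sum_le_sum fun X _ => le_trans (le_of_eq ?_) (Finset.card_switchings_le S X)
    rw [Finset.card_filter, Fintype.sum_prod_type]
    simp only [d, Finset.card_filter]
  have hcs := sq_sum_le_card_mul_sum_sq (s := Finset.univ) (f := d)
  rw [hsum, Finset.card_univ, Fintype.card_finset, ← hn] at hcs
  by_contra! hcon
  have h1 : ∑ X ∈ S, 2 ^ n * (n + 2 * (S ∩ X.pairNeighbors).card)
      < ∑ X ∈ S, n ^ 2 * S.card :=
    Finset.sum_lt_sum_of_nonempty hS hcon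
  rw [← Finset.mul_sum, Finset.sum_const, smul_eq_mul] at h1
  have h2 := hcs.trans (Nat.mul_le_mul_left _ hsq)
  have h3 : (n * S.card) ^ 2 = S.card * (n ^ 2 * S.card) := by ring
  rw [h3] at h2
  exact absurd h2 (not_le.2 h1)

theorem Finset.exists_mem_le_card_inter_pairNeighbors {α : Type*} [DecidableEq α] [Fintype α]
    [Nonempty α] (S : Finset (Finset α))
    (hS : 2 * (2 : ℝ) ^ Fintype.card α / Fintype.card α < S.card) :
    ∃ X ∈ S, ((Fintype.card α : ℝ) ^ 2 / (4 * 2 ^ Fintype.card α)) * S.card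
      ≤ (S ∩ X.pairNeighbors).card := by
  have hn : (0 : ℝ) < Fintype.card α := by exact_mod_cast Fintype.card_pos
  have hne : S.Nonempty := by
    rw [← Finset.card_pos]
    have : (0 : ℝ) < S.card := lt_trans (by positivity) hS
    exact_mod_cast this
  obtain ⟨X, hX, h⟩ := Finset.exists_mem_card_sq_le_pairNeighbors hne
  refine ⟨X, hX, ?_⟩
  have h' : (Fintype.card α : ℝ) ^ 2 * S.card
      ≤ 2 ^ Fintype.card α * (Fintype.card α + 2 * (S ∩ X.pairNeighbors).card) := by
    exact_mod_cast h
  rw [div_lt_iff₀ hn] at hS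
  rw [div_mul_eq_mul_div, div_le_iff₀ (by positivity)]
  nlinarith

/-! ### Feasible sets near an infeasible set -/

/-- A symmetric irreflexive relation in which every non-isolated element is related to an end of
every edge is complete multipartite on its non-isolated elements. The code of an element names its
part by a chosen representative, or is `none` when the element is isolated. -/
theorem exists_multipartite_code {α : Type*} (r : α → α → Prop) (hirr : ∀ a, ¬ r a a)
    (hsymm : ∀ a b, r a b → r b a)
    (h : ∀ a b c d, r a b → r c d → r c a ∨ r c b) :
    ∃ code : α → Option α, ∀ a b, r a b ↔ code a ≠ none ∧ code b ≠ none ∧ code a ≠ code b := by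
  classical
  let part : α → Set α := fun a => {x | (∃ y, r x y) ∧ (∃ y, r a y) ∧ ¬ r x a}
  let rep : Set α → Option α := fun s => if hs : s.Nonempty then some hs.choose else none
  have rep_none : ∀ s, rep s = none ↔ ¬ s.Nonempty := by
    intro s
    by_cases hs : s.Nonempty <;> simp [rep, hs]
  have rep_mem : ∀ s z, rep s = some z → z ∈ s := by
    intro s z hz
    by_cases hs : s.Nonempty
    · simp only [rep, hs, dite_true, Option.some.injEq] at hz
      exact hz ▸ hs.choose_spec
    · simp [rep, hs] at hz
  have code_none : ∀ a, rep (part a) ≠ none ↔ ∃ y, r a y := by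
    intro a
    rw [Ne, rep_none, not_not]
    exact ⟨fun ⟨_, hx⟩ => hx.2.1, fun ha => ⟨a, ha, ha, hirr a⟩⟩
  have part_eq : ∀ a b, (∃ y, r a y) → (∃ y, r b y) → ¬ r a b → part a ⊆ part b := by
    rintro a b ⟨y, ha⟩ hb hab x ⟨hx, -, hxa⟩
    refine ⟨hx, hb, fun hxb => ?_⟩
    rcases h x b a y hxb ha with h1 | h1
    exacts [hxa (hsymm _ _ h1), hab h1]
  refine ⟨fun a => rep (part a), fun a b => ⟨fun hab => ?_, fun ⟨h1, h2, h3⟩ => ?_⟩⟩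
  · refine ⟨(code_none a).2 ⟨b, hab⟩, (code_none b).2 ⟨a, hsymm _ _ hab⟩, fun heq => ?_⟩
    obtain ⟨z, hz⟩ := Option.ne_none_iff_exists'.1 ((code_none a).2 ⟨b, hab⟩)
    obtain ⟨⟨y, hy⟩, -, hza⟩ := rep_mem _ _ hz
    obtain ⟨-, -, hzb⟩ := rep_mem _ _ (heq.symm.trans hz)
    exact (h a b z y hab hy).elim hza hzb
  · by_contra hab
    rw [code_none] at h1 h2
    exact h3 (congrArg rep (Set.Subset.antisymm (part_eq a b h1 h2 hab)
      (part_eq b a h2 h1 fun hba => hab (hsymm _ _ hba))))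

namespace DeltaMatroid

variable {α : Type*} [DecidableEq α] [Fintype α]

/-- If `V` is infeasible, `{a, b}` and `{c, d}` switch `V` to feasible sets, then so does `{c, a}`
or `{c, b}`: exchange `d` from `symmDiff V {c, d}` towards `symmDiff V {a, b}`. -/
theorem IsEven.symmDiff_pair_mem {D : DeltaMatroid α} (hD : D.IsEven) {V : Finset α}
    (hV : V ∉ D.feasible) {a b c d : α} (hab : a ≠ b) (hcd : c ≠ d)
    (h1 : symmDiff V {a, b} ∈ D.feasible) (h2 : symmDiff V {c, d} ∈ D.feasible) :
    (c ≠ a ∧ symmDiff V {c, a} ∈ D.feasible) ∨ (c ≠ b ∧ symmDiff V {c, b} ∈ D.feasible) := by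
  by_cases hca : c = a
  · subst hca; exact Or.inr ⟨hab, h1⟩
  by_cases hcb : c = b
  · subst hcb; exact Or.inl ⟨hab.symm, by rwa [Finset.pair_comm]⟩
  by_cases hda : d = a
  · subst hda; exact Or.inl ⟨hcd, h2⟩
  by_cases hdb : d = b
  · subst hdb; exact Or.inr ⟨hcd, h2⟩
  have hXY : symmDiff (symmDiff V {c, d}) (symmDiff V {a, b}) = {a, b, c, d} := by
    ext x
    simp only [Finset.mem_symmDiff, Finset.mem_insert, Finset.mem_singleton]
    grind
  obtain ⟨f, hf, hfea⟩ := D.symm_exchange _ h2 _ h1 d (by rw [hXY]; simp)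
  rw [hXY] at hf
  have hswitch : ∀ x, x ≠ c → x ≠ d →
      symmDiff (symmDiff V {c, d}) {d, x} = symmDiff V {c, x} := by
    intro x hxc hxd
    ext y
    simp only [Finset.mem_symmDiff, Finset.mem_insert, Finset.mem_singleton]
    grind
  simp only [Finset.mem_insert, Finset.mem_singleton] at hf
  rcases hf with rfl | rfl | rfl | rfl
  · rw [hswitch _ (Ne.symm hca) (Ne.symm hda)] at hfea
    exact Or.inl ⟨hca, hfea⟩
  · rw [hswitch _ (Ne.symm hcb) (Ne.symm hdb)] at hfea
    exact Or.inr ⟨hcb, hfea⟩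
  · rw [Finset.pair_comm, symmDiff_symmDiff_cancel_right] at hfea
    exact absurd hfea hV
  · -- Switching `d` alone would change the parity.
    exfalso
    have := hD _ h2 _ hfea
    rw [← ZMod.natCast_eq_natCast_iff, Finset.card_symmDiff_zmod_two (symmDiff V {c, f})] at this
    simp at this

/-- The feasible families of the even delta-matroids on `α`. -/
noncomputable def evenFeasibleFamilies (α : Type*) [DecidableEq α] [Fintype α] :
    Finset (Finset (Finset α)) :=
  open Classical in Finset.univ.filter fun F => ∃ D : DeltaMatroid α, D.IsEven ∧ D.feasible = F

theorem card_traces_pairNeighbors_le (V : Finset α) :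
    (((evenFeasibleFamilies α).filter fun F => V ∉ F).traces V.pairNeighbors).card
      ≤ (Fintype.card α + 1) ^ Fintype.card α := by
  classical
  let decode : (α → Option α) → Finset (Finset α) := fun code =>
    (Finset.univ.filter fun p : α × α =>
      code p.1 ≠ none ∧ code p.2 ≠ none ∧ code p.1 ≠ code p.2).image
        fun p => symmDiff V {p.1, p.2}
  have hcard : (Finset.univ.image decode).card ≤ (Fintype.card α + 1) ^ Fintype.card α := by
    refine Finset.card_image_le.trans (le_of_eq ?_)
    rw [Finset.card_univ, Fintype.card_fun, Fintype.card_option]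
  refine le_trans (Finset.card_le_card fun T hT => ?_) hcard
  obtain ⟨F, hF, rfl⟩ := Finset.mem_image.1 hT
  obtain ⟨hF, hV⟩ := Finset.mem_filter.1 hF
  obtain ⟨D, hD, rfl⟩ : ∃ D : DeltaMatroid α, D.IsEven ∧ D.feasible = F := by
    simpa [evenFeasibleFamilies] using hF
  obtain ⟨code, hcode⟩ := exists_multipartite_code
    (fun a b => a ≠ b ∧ symmDiff V {a, b} ∈ D.feasible) (fun a h => h.1 rfl)
    (fun a b h => ⟨h.1.symm, by rw [Finset.pair_comm]; exact h.2⟩)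
    (fun a b c d h1 h2 => hD.symmDiff_pair_mem hV h1.1 h2.1 h1.2 h2.2)
  refine Finset.mem_image.2 ⟨code, Finset.mem_univ _, ?_⟩
  ext W
  simp only [decode, ← hcode, Finset.mem_image, Finset.mem_filter, Finset.mem_univ, true_and,
    Finset.mem_inter, Finset.pairNeighbors, Finset.mem_powersetCard, Finset.subset_univ]
  constructor
  · rintro ⟨p, ⟨hne, hp⟩, rfl⟩
    exact ⟨hp, _, Finset.card_pair hne, rfl⟩
  · rintro ⟨hW, T, hT, rfl⟩
    obtain ⟨a, b, hne, rfl⟩ := Finset.card_eq_two.1 hT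
    exact ⟨(a, b), ⟨hne, hW⟩, rfl⟩

end DeltaMatroid

theorem numEvenDeltaMatroids_le_card_traces (n : ℕ) :
    numEvenDeltaMatroids n
      ≤ ((DeltaMatroid.evenFeasibleFamilies (Fin n)).traces Finset.univ).card := by
  have h : Function.Injective (fun D : {D : DeltaMatroid (Fin n) // D.IsEven} =>
      (⟨D.1.feasible, by simpa [DeltaMatroid.evenFeasibleFamilies] using ⟨D.1, D.2, rfl⟩⟩ :
        {F // F ∈ DeltaMatroid.evenFeasibleFamilies (Fin n)})) := by
    intro D D' h
    exact Subtype.ext (DeltaMatroid.ext (congrArg Subtype.val h))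
  have := Nat.card_le_card_of_injective _ h
  rw [Nat.card_eq_fintype_card (α := {F // F ∈ _}), Fintype.card_coe] at this
  simpa [Finset.traces, numEvenDeltaMatroids] using this

/-! ### Asymptotics -/

theorem numEvenDeltaMatroids_pos (n : ℕ) : 0 < numEvenDeltaMatroids n :=
  (pow_pos two_pos n).trans_le (two_pow_le_numEvenDeltaMatroids n)

theorem two_le_logb_of_four_le {n : ℕ} (hn : 4 ≤ n) : 2 ≤ Real.logb 2 n := by
  have hn4 : (4 : ℝ) ≤ n := by exact_mod_cast hn
  rw [Real.le_logb_iff_rpow_le one_lt_two (by linarith)]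
  norm_num
  exact hn

theorem one_le_logb_logb_of_four_le {n : ℕ} (hn : 4 ≤ n) :
    1 ≤ Real.logb 2 (Real.logb 2 n) := by
  have hℓ := two_le_logb_of_four_le hn
  rw [Real.le_logb_iff_rpow_le one_lt_two (by linarith)]
  simpa using hℓ

/-- The bound from the branching count, once `q` steps suffice to shrink all `2 ^ n` sets to
`2 * 2 ^ n / n` of them. -/
theorem logb_numEvenDeltaMatroids_le {n : ℕ} (hn : 1 ≤ n) (q : ℕ)
    (hq : (1 - (n : ℝ) ^ 2 / (4 * 2 ^ n)) ^ q ≤ 2 / n) :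
    Real.logb 2 (numEvenDeltaMatroids n : ℝ)
      ≤ 2 * 2 ^ n / n + q * Real.logb 2 (1 + 2 ^ n * ((n : ℝ) + 1) ^ n) := by
  have hn0 : (0 : ℝ) < n := by exact_mod_cast hn
  have : Nonempty (Fin n) := ⟨⟨0, hn⟩⟩
  have h := Finset.card_traces_le_of_expansion (DeltaMatroid.evenFeasibleFamilies (Fin n))
    Finset.pairNeighbors DeltaMatroid.card_traces_pairNeighbors_le
    (s₀ := 2 * 2 ^ n / n) (β := (n : ℝ) ^ 2 / (4 * 2 ^ n)) (by positivity) (by positivity)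
    (by simpa using Finset.exists_mem_le_card_inter_pairNeighbors (α := Fin n))
    Finset.univ q (by
      have := mul_le_mul_of_nonneg_right hq (pow_nonneg (zero_le_two (α := ℝ)) n)
      rw [div_mul_eq_mul_div] at this
      simpa using this)
  have hle : (numEvenDeltaMatroids n : ℝ) ≤
      2 ^ (2 * 2 ^ n / n : ℝ) * (1 + 2 ^ n * ((n : ℝ) + 1) ^ n) ^ q := by
    refine le_trans (by exact_mod_cast numEvenDeltaMatroids_le_card_traces n) (h.trans (le_of_eq ?_))
    simp
  have hpos : (0 : ℝ) < numEvenDeltaMatroids n := by exact_mod_cast numEvenDeltaMatroids_pos n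
  refine (Real.logb_le_logb_of_le one_lt_two hpos hle).trans (le_of_eq ?_)
  rw [Real.logb_mul (by positivity) (by positivity), Real.logb_rpow two_pos (by norm_num),
    Real.logb_pow]

theorem logb_one_add_two_pow_mul_le {n : ℕ} (hn : 4 ≤ n) :
    Real.logb 2 (1 + 2 ^ n * ((n : ℝ) + 1) ^ n) ≤ 3 * n * Real.logb 2 n := by
  have hn4 : (4 : ℝ) ≤ n := by exact_mod_cast hn
  have hℓ := two_le_logb_of_four_le hn
  have h1 : (1 : ℝ) + 2 ^ n * ((n : ℝ) + 1) ^ n ≤ 2 * (2 ^ n * (2 * n) ^ n) := by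
    have h2 : ((n : ℝ) + 1) ^ n ≤ (2 * n) ^ n := pow_le_pow_left₀ (by linarith) (by linarith) n
    have h3 : (1 : ℝ) ≤ 2 ^ n * (2 * n) ^ n :=
      one_le_mul_of_one_le_of_one_le (one_le_pow₀ one_le_two) (one_le_pow₀ (by linarith))
    have h4 : (2 : ℝ) ^ n * ((n : ℝ) + 1) ^ n ≤ 2 ^ n * (2 * n) ^ n :=
      mul_le_mul_of_nonneg_left h2 (by positivity)
    linarith
  refine (Real.logb_le_logb_of_le one_lt_two (by positivity) h1).trans ?_
  rw [Real.logb_mul (by positivity) (by positivity), Real.logb_mul (by positivity) (by positivity),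
    Real.logb_pow, Real.logb_pow, Real.logb_mul (by positivity) (by positivity),
    Real.logb_self_eq_one one_lt_two]
  nlinarith

theorem logb_numEvenDeltaMatroids_le_sq {n : ℕ} (hn : 4 ≤ n) :
    Real.logb 2 (numEvenDeltaMatroids n : ℝ) ≤ 2 ^ n / n * (32 * Real.logb 2 n ^ 2) := by
  have hn4 : (4 : ℝ) ≤ n := by exact_mod_cast hn
  have hn0 : (0 : ℝ) < n := by linarith
  have hℓ := two_le_logb_of_four_le hn
  set ℓ := Real.logb 2 n with hℓdef
  have hlog : Real.log n ≤ ℓ := by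
    rw [hℓdef, Real.logb, le_div_iff₀ (Real.log_pos one_lt_two)]
    have h1 : Real.log 2 ≤ 1 := by linarith [Real.log_two_lt_d9]
    exact mul_le_of_le_one_right (Real.log_nonneg (by linarith)) h1
  have hsq : (n : ℝ) ^ 2 ≤ 2 ^ n := by
    have : ∀ m : ℕ, 4 ≤ m → m ^ 2 ≤ 2 ^ m := by
      intro m hm
      induction m, hm using Nat.le_induction with
      | base => norm_num
      | succ m hm ih => rw [pow_succ 2]; nlinarith
    exact_mod_cast this n hn
  set β : ℝ := (n : ℝ) ^ 2 / (4 * 2 ^ n) with hβ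
  have hβ0 : 0 < β := by positivity
  have hβ1 : β ≤ 1 := by
    rw [hβ, div_le_one (by positivity)]; linarith [pow_pos (two_pos (α := ℝ)) n]
  obtain ⟨q, hq1, hq2⟩ : ∃ q : ℕ, ℓ / β ≤ q ∧ (q : ℝ) < ℓ / β + 1 :=
    ⟨_, Nat.le_ceil _, Nat.ceil_lt_add_one (by positivity)⟩
  have hq : (1 - β) ^ q ≤ 2 / n := by
    calc (1 - β) ^ q ≤ Real.exp (-β) ^ q :=
          pow_le_pow_left₀ (by linarith) (Real.one_sub_le_exp_neg β) q
      _ = Real.exp (-(β * q)) := by rw [← Real.exp_nat_mul]; ring_nf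
      _ ≤ Real.exp (-Real.log n) := by
          rw [Real.exp_le_exp, neg_le_neg_iff]
          rw [div_le_iff₀ hβ0] at hq1
          linarith
      _ = 1 / n := by rw [Real.exp_neg, Real.exp_log hn0, one_div]
      _ ≤ 2 / n := by gcongr; norm_num
  have hqle : (q : ℝ) ≤ 8 * 2 ^ n * ℓ / n ^ 2 := by
    have h1 : 1 ≤ ℓ / β := by rw [le_div_iff₀ hβ0]; linarith
    have h2 : ℓ / β = 4 * 2 ^ n * ℓ / n ^ 2 := by rw [hβ]; field_simp
    have h3 : 8 * 2 ^ n * ℓ / (n : ℝ) ^ 2 = 2 * (ℓ / β) := by rw [h2]; ring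
    rw [h3]; linarith
  have hp : (0 : ℝ) < 2 ^ n / n := by positivity
  calc Real.logb 2 (numEvenDeltaMatroids n : ℝ)
      ≤ 2 * 2 ^ n / n + q * Real.logb 2 (1 + 2 ^ n * ((n : ℝ) + 1) ^ n) :=
        logb_numEvenDeltaMatroids_le (by omega) q hq
    _ ≤ 2 * 2 ^ n / n + 8 * 2 ^ n * ℓ / n ^ 2 * (3 * n * ℓ) := by
        have h1 := logb_one_add_two_pow_mul_le hn
        have h2 : (0 : ℝ) ≤ 3 * n * ℓ := by positivity
        have := (mul_le_mul_of_nonneg_left h1 (Nat.cast_nonneg q)).trans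
          (mul_le_mul_of_nonneg_right hqle h2)
        linarith
    _ = 2 ^ n / n * (2 + 24 * ℓ ^ 2) := by field_simp; ring
    _ ≤ 2 ^ n / n * (32 * ℓ ^ 2) := by
        apply mul_le_mul_of_nonneg_left _ hp.le
        nlinarith

theorem logb_logb_numEvenDeltaMatroids_le {n : ℕ} (hn : 4 ≤ n) :
    Real.logb 2 (Real.logb 2 (numEvenDeltaMatroids n : ℝ))
      ≤ n - Real.logb 2 n + 7 * Real.logb 2 (Real.logb 2 n) := by
  have hℓ := two_le_logb_of_four_le hn
  have hℓℓ := one_le_logb_logb_of_four_le hn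
  have hpos : 0 < Real.logb 2 (numEvenDeltaMatroids n : ℝ) := by
    apply Real.logb_pos one_lt_two
    have h1 : 1 < 2 ^ n := Nat.one_lt_two_pow (by omega)
    exact_mod_cast h1.trans_le (two_pow_le_numEvenDeltaMatroids n)
  refine (Real.logb_le_logb_of_le one_lt_two hpos (logb_numEvenDeltaMatroids_le_sq hn)).trans ?_
  have h32 : Real.logb 2 32 = 5 := by
    rw [show (32 : ℝ) = 2 ^ (5 : ℝ) by norm_num, Real.logb_rpow two_pos (by norm_num)]
  rw [Real.logb_mul (by positivity) (by positivity), Real.logb_div (by positivity) (by positivity),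
    Real.logb_mul (by norm_num) (by positivity), Real.logb_pow, Real.logb_pow, h32,
    Real.logb_self_eq_one one_lt_two]
  push_cast
  linarith

theorem theorem3 :
    (∀ n : ℕ, 1 ≤ n →
      (n : ℝ) - Real.logb 2 (n : ℝ) - 1
        ≤ Real.logb 2 (Real.logb 2 (numEvenDeltaMatroids n : ℝ))) ∧
    ∃ g : ℕ → ℝ,
      Asymptotics.IsBigO Filter.atTop g
        (fun n : ℕ => Real.logb 2 (Real.logb 2 (n : ℝ))) ∧
      ∀ n : ℕ, 1 ≤ n →
        Real.logb 2 (Real.logb 2 (numEvenDeltaMatroids n : ℝ))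
          ≤ (n : ℝ) - Real.logb 2 (n : ℝ) + g n := by
  -- The error term is the exact difference, so the lower bound is needed to bound it from below.
  refine ⟨fun n hn => sub_logb_sub_one_le_logb_logb_numEvenDeltaMatroids hn,
    fun n => Real.logb 2 (Real.logb 2 (numEvenDeltaMatroids n : ℝ)) - (n - Real.logb 2 n),
    ?_, fun n _ => by linarith⟩
  refine Asymptotics.IsBigO.of_bound 7 (Filter.eventually_atTop.2 ⟨4, fun n hn => ?_⟩)
  have hℓ := two_le_logb_of_four_le hn
  have hℓℓ := one_le_logb_logb_of_four_le hn
  have hlow := sub_logb_sub_one_le_logb_logb_numEvenDeltaMatroids (n := n) (by omega)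
  have hup := logb_logb_numEvenDeltaMatroids_le hn
  rw [Real.norm_eq_abs, Real.norm_eq_abs, abs_of_nonneg (by linarith : (0:ℝ) ≤ Real.logb 2 _),
    abs_le]
  constructor <;> linarith
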